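/- Let $\Sigma$ be a many-sorted first-order signature (non-empty set of sorts $\mathcal S_\Sigma$, function and predicate symbols with arities, equality on every sort). It is countable and its sorts and symbols are coded injectively by natural numbers, so that formulas are finite strings over a coded alphabet and one can speak of computable functions on the set $\mathrm{QF}(\Sigma)$ of quantifier-free formulas. Interpretations consist of non-empty domains $\sigma^{\mathcal A}$ for the sorts $\sigma$, meanings of the symbols, and values of the variables (countably many of each sort). A theory $\mathcal T$ is the class of all interpretations (the $\mathcal T$-interpretations) satisfying a given set of sentences; "$\mathcal T$-satisfiable" means satisfied by some $\mathcal T$-interpretation, and two formulas are $\mathcal T$-equivalent if they are satisfied by the same $\mathcal T$-interpretations. For a formula $\psi$, $\mathrm{vars}(\psi)$ is the set of its free variables, $\mathrm{vars}_\sigma(\psi)$ the set of those of sort $\sigma$, and $\mathrm{vars}_\sigma(\psi)^{\mathcal A}$ the set of their values in $\mathcal A$. Let $S\subseteq\mathcal S_\Sigma$. With respect to $S$, the theory $\mathcal T$ * is *smooth* if for every $\varphi\in\mathrm{QF}(\Sigma)$, every $\mathcal T$-interpretation $\mathcal A\vDash\varphi$ and every function $\kappa$ from $S$ to the cardinals with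 $\kappa(\sigma)\ge|\sigma^{\mathcal A}|$ for all $\sigma\in S$, there is a $\mathcal T$-interpretation $\mathcal B\vDash\varphi$ with $|\sigma^{\mathcal B}|=\kappa(\sigma)$ for all $\sigma\in S$; * is *stably finite* if for every $\varphi\in\mathrm{QF}(\Sigma)$ and $\mathcal T$-interpretation $\mathcal A\vDash\varphi$ there is a $\mathcal T$-interpretation $\mathcal B\vDash\varphi$ with $|\sigma^{\mathcal B}|<\aleph_0$ and $|\sigma^{\mathcal B}|\le|\sigma^{\mathcal A}|$ for all $\sigma\in S$; * has the *minimal model function* $\mathsf{MM}$, a total function on $\mathrm{QF}(\Sigma)$ whose values are sets of functions from $S$ to the cardinals, if for every $\mathcal T$-satisfiable $\varphi\in\mathrm{QF}(\Sigma)$: (i) every $\mathbf n\in\mathsf{MM}(\varphi)$ is $\sigma\mapsto|\sigma^{\mathcal A}|$ for some $\mathcal T$-interpretation $\mathcal A\vDash\varphi$; (ii) for distinct $\mathbf m,\mathbf n\in\mathsf{MM}(\varphi)$ there is $\sigma\in S$ with $\mathbf m(\sigma)<\mathbf n(\sigma)$; (iii) for every $\mathcal T$-interpretation $\mathcal A\vDash\varphi$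 there is $\mathbf n\in\mathsf{MM}(\varphi)$ with $\mathbf n(\sigma)\le|\sigma^{\mathcal A}|$ for all $\sigma\in S$. It is *computable* if from $\varphi$ one can compute $\mathsf{MM}(\varphi)$ as a finite list of functions $S\to\mathbb N\cup\{\aleph_0\}$; * is *shiny* if it is smooth, stably finite and has a computable minimal model function; * has the *witness* $\mathit{wit}:\mathrm{QF}(\Sigma)\to\mathrm{QF}(\Sigma)$, a computable function, if for every $\varphi\in\mathrm{QF}(\Sigma)$: $\varphi$ and $\exists\vec x\,\mathit{wit}(\varphi)$ are $\mathcal T$-equivalent, where $\vec x=\mathrm{vars}(\mathit{wit}(\varphi))\setminus\mathrm{vars}(\varphi)$; and if $\mathit{wit}(\varphi)$ is $\mathcal T$-satisfiable, there is a $\mathcal T$-interpretation $\mathcal A\vDash\varphi$ with $\sigma^{\mathcal A}=\mathrm{vars}_\sigma(\mathit{wit}(\varphi))^{\mathcal A}$ for all $\sigma\in S$; * has the *strong witness* $\mathit{wit}$ if $\mathit{wit}$ is a witness and, for every $\varphi\in\mathrm{QF}(\Sigma)$, every finite set $V$ of variables with sorts in $S$ and every equivalence relation $E$ on $V$ relating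 only variables of equal sort, with arrangement $\delta_V$ (the conjunction of the literals $x=y$ for $x\mathrel{E}y$ and $\neg(x=y)$ for $x,y\in V$ of equal sort that are not $E$-related): if $\mathit{wit}(\varphi)\wedge\delta_V$ is $\mathcal T$-satisfiable, there is a $\mathcal T$-interpretation $\mathcal A\vDash\mathit{wit}(\varphi)\wedge\delta_V$ with $\sigma^{\mathcal A}=\mathrm{vars}_\sigma(\mathit{wit}(\varphi)\wedge\delta_V)^{\mathcal A}$ for all $\sigma\in S$; * is *polite* (respectively *strongly polite*) if it is smooth and has a witness (respectively a strong witness); * is a *Unicorn 3.0 theory* if it is polite and shiny but not strongly polite. **Theorem.** If a theory $\mathcal T$ over $\Sigma$ is shiny with respect to a finite set of sorts $S$, then it is strongly polite with respect to $S$. Moreover, there are no Unicorn 3.0 theories over $\Sigma$, with respect to any set of sorts. -/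

import Mathlib

universe u v

namespace ManySorted

/-- A many-sorted signature. Equality on every sort is built into the formulas below, so `Rel`
lists the predicate symbols other than the equalities. -/
structure Signature where
  Srt : Type v
  Func : Type v
  Rel : Type v
  dom : Func → List Srt
  cod : Func → Srt
  ar : Rel → List Srt
  nonempty_srt : Nonempty Srt

/-- Variables: countably many of each sort; the first component is the sort. -/
abbrev Var (Sig : Signature.{v}) : Type v := Sig.Srt × ℕ

/-- (Well-sorted) terms. -/
inductive Term (Sig : Signature.{v}) : Sig.Srt → Type v
  | var (x : Var Sig) : Term Sig x.1
  | app (f : Sig.Func) (args : ∀ i : Fin (Sig.dom f).length, Term Sig ((Sig.dom f).get i)) :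
      Term Sig (Sig.cod f)

/-- First-order formulas. -/
inductive Formula (Sig : Signature.{v}) : Type v
  | tru : Formula Sig
  | eq (σ : Sig.Srt) (s t : Term Sig σ) : Formula Sig
  | rel (P : Sig.Rel) (args : ∀ i : Fin (Sig.ar P).length, Term Sig ((Sig.ar P).get i)) :
      Formula Sig
  | neg (φ : Formula Sig) : Formula Sig
  | and (φ ψ : Formula Sig) : Formula Sig
  | or (φ ψ : Formula Sig) : Formula Sig
  | all (x : Var Sig) (φ : Formula Sig) : Formula Sig
  | ex (x : Var Sig) (φ : Formula Sig) : Formula Sig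

open Classical in
/-- The variables of a term. -/
noncomputable def Term.vars {Sig : Signature.{v}} : {σ : Sig.Srt} → Term Sig σ → Finset (Var Sig)
  | _, .var x => {x}
  | _, .app _ args => Finset.univ.biUnion fun i => (args i).vars

namespace Formula

variable {Sig : Signature.{v}}

open Classical in
/-- The free variables of a formula. -/
noncomputable def vars : Formula Sig → Finset (Var Sig)
  | tru => ∅
  | eq _ s t => s.vars ∪ t.vars
  | rel _ args => Finset.univ.biUnion fun i => (args i).vars
  | neg φ => φ.vars
  | and φ ψ => φ.vars ∪ ψ.vars
  | or φ ψ => φ.vars ∪ ψ.vars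
  | all x φ => φ.vars.erase x
  | ex x φ => φ.vars.erase x

/-- Quantifier-free formulas. -/
def IsQF : Formula Sig → Prop
  | tru => True
  | eq _ _ _ => True
  | rel _ _ => True
  | neg φ => φ.IsQF
  | and φ ψ => φ.IsQF ∧ ψ.IsQF
  | or φ ψ => φ.IsQF ∧ ψ.IsQF
  | all _ _ => False
  | ex _ _ => False

/-- `∃ x₁ … xₖ, φ`, where `V = {x₁, …, xₖ}`. -/
noncomputable def exs (V : Finset (Var Sig)) (φ : Formula Sig) : Formula Sig :=
  V.toList.foldr ex φ

/-- Conjunction of a finite list of formulas. -/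
def conj (l : List (Formula Sig)) : Formula Sig := l.foldr and tru

open Classical in
/-- The literal contributed to the arrangement by the pair `(x, y)`: `x = y` if `x E y`, and
`¬ (x = y)` otherwise. There is no such literal (trivial conjunct) if the sorts differ. -/
noncomputable def arrLit {V : Finset (Var Sig)} (E : Setoid V) (x y : V) : Formula Sig :=
  if h : y.1.1 = x.1.1 then
    if E x y then eq x.1.1 (.var x.1) (h ▸ .var y.1)
    else neg (eq x.1.1 (.var x.1) (h ▸ .var y.1))
  else tru

/-- The arrangement on `V` induced by the equivalence relation `E`. -/
noncomputable def arrangement (V : Finset (Var Sig)) (E : Setoid V) : Formula Sig :=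
  conj (((Finset.univ : Finset (V × V)).toList).map fun p => arrLit E p.1 p.2)

end Formula

/-- The type of quantifier-free formulas. -/
abbrev QF (Sig : Signature.{v}) : Type v := {φ : Formula Sig // φ.IsQF}

/-! ### Semantics -/

/-- Interpretations: structures with nonempty domains, together with values of the variables. -/
structure Interp (Sig : Signature.{v}) where
  carrier : Sig.Srt → Type u
  nonempty_carrier : ∀ σ, Nonempty (carrier σ)
  func : ∀ f : Sig.Func,
    (∀ i : Fin (Sig.dom f).length, carrier ((Sig.dom f).get i)) → carrier (Sig.cod f)
  rel : ∀ P : Sig.Rel, (∀ i : Fin (Sig.ar P).length, carrier ((Sig.ar P).get i)) → Prop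
  val : ∀ x : Var Sig, carrier x.1

namespace Interp

variable {Sig : Signature.{v}}

open Classical in
/-- The interpretation that agrees with `A` except that the variable `x` has the value `a`. -/
noncomputable def update (A : Interp.{u} Sig) (x : Var Sig) (a : A.carrier x.1) :
    Interp.{u} Sig :=
  { A with val := Function.update A.val x a }

/-- The value of a term. -/
def eval (A : Interp.{u} Sig) : {σ : Sig.Srt} → Term Sig σ → A.carrier σ
  | _, .var x => A.val x
  | _, .app f args => A.func f fun i => A.eval (args i)

end Interp

/-- Satisfaction. -/
def Formula.Sat {Sig : Signature.{v}} : Formula Sig → Interp.{u} Sig → Prop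
  | .tru, _ => True
  | .eq _ s t, A => A.eval s = A.eval t
  | .rel P args, A => A.rel P fun i => A.eval (args i)
  | .neg φ, A => ¬ φ.Sat A
  | .and φ ψ, A => φ.Sat A ∧ ψ.Sat A
  | .or φ ψ, A => φ.Sat A ∨ ψ.Sat A
  | .all x φ, A => ∀ a : A.carrier x.1, φ.Sat (A.update x a)
  | .ex x φ, A => ∃ a : A.carrier x.1, φ.Sat (A.update x a)

/-- `A` satisfies `σ^A = vars_σ(φ)^A` for every sort `σ ∈ S`. -/
def Interp.NamedBy {Sig : Signature.{v}} (A : Interp.{u} Sig) (S : Set Sig.Srt)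
    (φ : Formula Sig) : Prop :=
  ∀ σ ∈ S, (Set.univ : Set (A.carrier σ)) = {a | ∃ i : ℕ, (σ, i) ∈ φ.vars ∧ A.val (σ, i) = a}

/-- A theory is given by its axiomatization, a set of sentences. -/
structure Theory (Sig : Signature.{v}) where
  ax : Set (Formula Sig)
  closed : ∀ φ ∈ ax, φ.vars = ∅

/-! ### Computability

A formula is written, in Polish (prefix) notation, as a string of tokens. A token is a triple
(kind of token, code of the sort or symbol, index of the variable). -/

abbrev Token : Type := ℕ × ℕ × ℕ

section Strings

variable {Sig : Signature.{v}} [Encodable Sig.Srt] [Encodable Sig.Func] [Encodable Sig.Rel]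

/-- The string of a term. -/
def Term.str : {σ : Sig.Srt} → Term Sig σ → List Token
  | _, .var x => [(0, Encodable.encode x.1, x.2)]
  | _, .app f args => (1, Encodable.encode f, 0) :: (List.ofFn fun i => (args i).str).flatten

/-- The string of a formula. -/
def Formula.str : Formula Sig → List Token
  | .rel P args => (2, Encodable.encode P, 0) :: (List.ofFn fun i => (args i).str).flatten
  | .eq σ s t => (3, Encodable.encode σ, 0) :: (s.str ++ t.str)
  | .tru => [(4, 0, 0)]
  | .neg φ => (5, 0, 0) :: φ.str
  | .and φ ψ => (6, 0, 0) :: (φ.str ++ ψ.str)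
  | .or φ ψ => (7, 0, 0) :: (φ.str ++ ψ.str)
  | .all x φ => (8, Encodable.encode x.1, x.2) :: φ.str
  | .ex x φ => (9, Encodable.encode x.1, x.2) :: φ.str

/-- `w` is a computable function from quantifier-free formulas to quantifier-free formulas. -/
def ComputableQF (w : QF Sig → QF Sig) : Prop :=
  ∃ g : List Token → List Token, Computable g ∧ ∀ φ : QF Sig, g φ.1.str = (w φ).1.str

/-- A cardinal in `ℕ ∪ {ℵ₀}` written as a finite object; `none` stands for `ℵ₀`. -/
def toCard : Option ℕ → Cardinal.{u}
  | none => Cardinal.aleph0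
  | some n => (n : Cardinal.{u})

/-- A function that maps quantifier-free formulas to sets of functions from `S` to the cardinals
is computable: from (the string of) `φ` one can compute the number `N` of entries of a finite
list `n₀, …, n_{N-1}` of functions `S → ℕ ∪ {ℵ₀}` whose set of members is `M φ`, and one can
compute the value `nᵢ(σ)` from `φ`, `i` and (the code of) `σ`. -/
def ComputableCards {S : Set Sig.Srt} (M : QF Sig → Set (S → Cardinal.{u})) : Prop :=
  ∃ (N : List Token → ℕ) (c : List Token → ℕ → ℕ → Option ℕ),
    Computable N ∧
    Computable (fun p : List Token × ℕ × ℕ => c p.1 p.2.1 p.2.2) ∧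
    ∀ φ : QF Sig, M φ = {n | ∃ i < N φ.1.str,
      ∀ σ : S, n σ = toCard (c φ.1.str i (Encodable.encode (σ : Sig.Srt)))}

end Strings

/-! ### Theory combination properties -/

namespace Theory

variable {Sig : Signature.{v}}

/-- `A` is a `T`-interpretation. -/
def IsModel (T : Theory Sig) (A : Interp.{u} Sig) : Prop := ∀ φ ∈ T.ax, φ.Sat A

/-- `φ` is `T`-satisfiable. -/
def Satisfiable (T : Theory Sig) (φ : Formula Sig) : Prop :=
  ∃ A : Interp.{u} Sig, T.IsModel A ∧ φ.Sat A

/-- `φ` and `ψ` are `T`-equivalent. -/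
def Equivalent (T : Theory Sig) (φ ψ : Formula Sig) : Prop :=
  ∀ A : Interp.{u} Sig, T.IsModel A → (φ.Sat A ↔ ψ.Sat A)

/-- Smoothness with respect to `S`. -/
def Smooth (T : Theory Sig) (S : Set Sig.Srt) : Prop :=
  ∀ (φ : QF Sig) (A : Interp.{u} Sig), T.IsModel A → φ.1.Sat A →
    ∀ κ : S → Cardinal.{u}, (∀ σ : S, Cardinal.mk (A.carrier σ) ≤ κ σ) →
      ∃ B : Interp.{u} Sig, T.IsModel B ∧ φ.1.Sat B ∧
        ∀ σ : S, Cardinal.mk (B.carrier σ) = κ σ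

/-- Stable finiteness with respect to `S`. -/
def StablyFinite (T : Theory Sig) (S : Set Sig.Srt) : Prop :=
  ∀ (φ : QF Sig) (A : Interp.{u} Sig), T.IsModel A → φ.1.Sat A →
    ∃ B : Interp.{u} Sig, T.IsModel B ∧ φ.1.Sat B ∧
      ∀ σ ∈ S, Cardinal.mk (B.carrier σ) < Cardinal.aleph0 ∧
        Cardinal.mk (B.carrier σ) ≤ Cardinal.mk (A.carrier σ)

/-- `M` is a minimal model function for `T` with respect to `S`. -/
def IsMinimalModelFunction (T : Theory Sig) (S : Set Sig.Srt)
    (M : QF Sig → Set (S → Cardinal.{u})) : Prop :=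
  ∀ φ : QF Sig, Satisfiable.{u} T φ.1 →
    (∀ n ∈ M φ, ∃ A : Interp.{u} Sig, T.IsModel A ∧ φ.1.Sat A ∧
      ∀ σ : S, n σ = Cardinal.mk (A.carrier σ)) ∧
    (∀ m ∈ M φ, ∀ n ∈ M φ, m ≠ n → ∃ σ : S, m σ < n σ) ∧
    (∀ A : Interp.{u} Sig, T.IsModel A → φ.1.Sat A →
      ∃ n ∈ M φ, ∀ σ : S, n σ ≤ Cardinal.mk (A.carrier σ))

variable [Encodable Sig.Srt] [Encodable Sig.Func] [Encodable Sig.Rel]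

open Classical in
/-- `wit` is a witness for `T` with respect to `S`. -/
def IsWitness (T : Theory Sig) (S : Set Sig.Srt) (wit : QF Sig → QF Sig) : Prop :=
  ComputableQF wit ∧
  ∀ φ : QF Sig,
    Equivalent.{u} T φ.1 (Formula.exs ((wit φ).1.vars \ φ.1.vars) (wit φ).1) ∧
    (Satisfiable.{u} T (wit φ).1 →
      ∃ A : Interp.{u} Sig, T.IsModel A ∧ φ.1.Sat A ∧ A.NamedBy S (wit φ).1)

/-- `wit` is a strong witness for `T` with respect to `S`. -/
def IsStrongWitness (T : Theory Sig) (S : Set Sig.Srt) (wit : QF Sig → QF Sig) : Prop :=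
  IsWitness.{u} T S wit ∧
  ∀ (φ : QF Sig) (V : Finset (Var Sig)) (E : Setoid V),
    (∀ x ∈ V, x.1 ∈ S) → (∀ x y : V, E x y → x.1.1 = y.1.1) →
    Satisfiable.{u} T ((wit φ).1.and (Formula.arrangement V E)) →
    ∃ A : Interp.{u} Sig, T.IsModel A ∧ ((wit φ).1.and (Formula.arrangement V E)).Sat A ∧
      A.NamedBy S ((wit φ).1.and (Formula.arrangement V E))

def FinitelyWitnessable (T : Theory Sig) (S : Set Sig.Srt) : Prop :=
  ∃ wit : QF Sig → QF Sig, IsWitness.{u} T S wit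

def StronglyFinitelyWitnessable (T : Theory Sig) (S : Set Sig.Srt) : Prop :=
  ∃ wit : QF Sig → QF Sig, IsStrongWitness.{u} T S wit

def Polite (T : Theory Sig) (S : Set Sig.Srt) : Prop :=
  Smooth.{u} T S ∧ FinitelyWitnessable.{u} T S

def StronglyPolite (T : Theory Sig) (S : Set Sig.Srt) : Prop :=
  Smooth.{u} T S ∧ StronglyFinitelyWitnessable.{u} T S

def Shiny (T : Theory Sig) (S : Set Sig.Srt) : Prop :=
  Smooth.{u} T S ∧ StablyFinite.{u} T S ∧
    ∃ M : QF Sig → Set (S → Cardinal.{u}), IsMinimalModelFunction.{u} T S M ∧ ComputableCards M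

/-- Unicorn 3.0 theories with respect to `S`. -/
def Unicorn3 (T : Theory Sig) (S : Set Sig.Srt) : Prop :=
  Polite.{u} T S ∧ Shiny.{u} T S ∧ ¬ StronglyPolite.{u} T S

end Theory

end ManySorted

/-! The strong witness of `φ` first guesses which variables of `φ` of equal sort are equal,
splitting `φ` into formulas `ψ` that decide all these equalities. For each `ψ` and each minimal size
`n` of `ψ` it adds `n σ` distinct fresh variables of every sort `σ` in `S`, and it is the
disjunction of the results. Stable finiteness makes the minimal sizes finite, so this is a formula,
and computability of the minimal model function makes it computable from `φ`.

Every model of `φ` has at least some minimal size of its `ψ`, so the fresh variables can be given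
distinct values (`Theory.exists_withVal_sat_witness`). Conversely, let `A` satisfy the witness and
an arrangement. The fresh variables force the set of named values in `A` to be at least as large as
a minimal model of `ψ`. Smoothness enlarges that model to exactly the size of this finite set. Since
`ψ` fixes the equality pattern of its own variables, a bijection carries the named values of `A`
onto the new domains compatibly with `ψ`, and all remaining variables are revalued along it
(`Theory.Smooth.exists_named`, `Theory.exists_named_of_sat_witness`). Equalities are preserved, so
the arrangement survives, and every element is named.

For Unicorn 3.0 theories, politeness forces `S` to be finite as soon as there is a model
(`Theory.Polite.finite`); without models everything is vacuous. -/

namespace ManySorted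

/-! ### Satisfaction, changes of variable values, conjunctions, disjunctions and arrangements. -/

section Semantics

variable {Sig : Signature.{v}}

/-- The interpretation that agrees with `A` except that the variables have the values `w`. -/
def Interp.withVal (A : Interp.{u} Sig) (w : ∀ x : Var Sig, A.carrier x.1) : Interp.{u} Sig :=
  { A with val := w }

theorem Interp.eval_withVal_congr (A : Interp.{u} Sig) {v w : ∀ x : Var Sig, A.carrier x.1}
    {σ : Sig.Srt} (t : Term Sig σ) (h : ∀ x ∈ t.vars, v x = w x) :
    (A.withVal v).eval t = (A.withVal w).eval t := by
  induction t with
  | var x => exact h x (by simp [Term.vars])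
  | app f args ih =>
    have hargs : ∀ i, (A.withVal v).eval (args i) = (A.withVal w).eval (args i) := fun i =>
      ih i fun x hx => h x <| by
        simp only [Term.vars, Finset.mem_biUnion, Finset.mem_univ, true_and]
        exact ⟨i, hx⟩
    exact congrArg (A.func f) (funext hargs)

/-- The valuations are generalized because a quantifier replaces `v` by `Function.update v x a`;
updates of `A.withVal v` are definitionally again of the form `A.withVal _`. -/
theorem Formula.sat_withVal_congr (A : Interp.{u} Sig) (φ : Formula Sig)
    {v w : ∀ x : Var Sig, A.carrier x.1} (h : ∀ x ∈ φ.vars, v x = w x) :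
    φ.Sat (A.withVal v) ↔ φ.Sat (A.withVal w) := by
  classical
  have upd : ∀ (x : Var Sig) (s : Finset (Var Sig)) (a : A.carrier x.1)
      (v w : ∀ x : Var Sig, A.carrier x.1), (∀ y ∈ s.erase x, v y = w y) →
      ∀ y ∈ s, Function.update v x a y = Function.update w x a y := by
    intro x s a v w h y hy
    by_cases hyx : y = x
    · subst hyx; simp
    · simp [Function.update_of_ne hyx, h y (Finset.mem_erase.2 ⟨hyx, hy⟩)]
  induction φ generalizing v w with
  | tru => exact Iff.rfl
  | eq σ s t =>
    simp only [Formula.vars, Finset.mem_union] at h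
    have hs := A.eval_withVal_congr s fun x hx => h x (Or.inl hx)
    have ht := A.eval_withVal_congr t fun x hx => h x (Or.inr hx)
    change _ = _ ↔ _ = _
    rw [hs, ht]
    exact Iff.rfl
  | rel P args =>
    have hargs : ∀ i, (A.withVal v).eval (args i) = (A.withVal w).eval (args i) := fun i =>
      A.eval_withVal_congr _ fun x hx => h x <| by
        simp only [Formula.vars, Finset.mem_biUnion, Finset.mem_univ, true_and]
        exact ⟨i, hx⟩
    exact iff_of_eq (congrArg (A.rel P) (funext hargs))
  | neg φ ih => exact not_congr (ih h)
  | and φ ψ ihφ ihψ =>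
    simp only [Formula.vars, Finset.mem_union] at h
    exact and_congr (ihφ fun x hx => h x (Or.inl hx)) (ihψ fun x hx => h x (Or.inr hx))
  | or φ ψ ihφ ihψ =>
    simp only [Formula.vars, Finset.mem_union] at h
    exact or_congr (ihφ fun x hx => h x (Or.inl hx)) (ihψ fun x hx => h x (Or.inr hx))
  | all x φ ih =>
    exact forall_congr' fun a => ih (upd x φ.vars a v w fun y hy => h y (by simpa [Formula.vars] using hy))
  | ex x φ ih =>
    exact exists_congr fun a => ih (upd x φ.vars a v w fun y hy => h y (by simpa [Formula.vars] using hy))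

/-- Axioms have no free variables, so values of variables can be changed freely without leaving the
theory. -/
theorem Theory.isModel_withVal {T : Theory Sig} {A : Interp.{u} Sig} (hA : T.IsModel A)
    (w : ∀ x : Var Sig, A.carrier x.1) : T.IsModel (A.withVal w) := fun φ hφ =>
  (φ.sat_withVal_congr A (v := A.val) (by simp [T.closed φ hφ])).1 (hA φ hφ)

theorem Formula.sat_exs (V : Finset (Var Sig)) (φ : Formula Sig) (A : Interp.{u} Sig) :
    (Formula.exs V φ).Sat A ↔
      ∃ w : ∀ x : Var Sig, A.carrier x.1, (∀ x ∉ V, w x = A.val x) ∧ φ.Sat (A.withVal w) := by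
  classical
  have key : ∀ (l : List (Var Sig)) (A : Interp.{u} Sig), (l.foldr Formula.ex φ).Sat A ↔
      ∃ w : ∀ x : Var Sig, A.carrier x.1, (∀ x ∉ l, w x = A.val x) ∧ φ.Sat (A.withVal w) := by
    intro l
    induction l with
    | nil =>
      intro A
      refine ⟨fun h => ⟨A.val, fun _ _ => rfl, h⟩, ?_⟩
      rintro ⟨w, hw, h⟩
      obtain rfl : w = A.val := funext fun x => hw x (by simp)
      exact h
    | cons x l ih =>
      intro A
      refine (exists_congr fun a => ih (A.update x a)).trans ⟨?_, ?_⟩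
      · rintro ⟨a, w, hw, h⟩
        refine ⟨w, fun y hy => ?_, h⟩
        rw [List.mem_cons, not_or] at hy
        exact (hw y hy.2).trans (Function.update_of_ne hy.1 _ _)
      · rintro ⟨w, hw, h⟩
        refine ⟨w x, w, fun y hy => ?_, h⟩
        by_cases hyx : y = x
        · subst hyx
          exact (Function.update_self (f := A.val) _ _).symm
        · exact (hw y (by simp [hyx, hy])).trans (Function.update_of_ne hyx _ _).symm
  have h := key V.toList A
  simp only [Finset.mem_toList] at h
  exact h

theorem Formula.sat_conj (l : List (Formula Sig)) (A : Interp.{u} Sig) :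
    (Formula.conj l).Sat A ↔ ∀ φ ∈ l, φ.Sat A := by
  induction l with
  | nil => simp [Formula.conj, Formula.Sat]
  | cons φ l ih =>
    simp only [List.mem_cons, forall_eq_or_imp, ← ih]
    exact Iff.rfl

theorem Formula.mem_vars_conj (l : List (Formula Sig)) (x : Var Sig) :
    x ∈ (Formula.conj l).vars ↔ ∃ φ ∈ l, x ∈ φ.vars := by
  induction l with
  | nil => simp [Formula.conj, Formula.vars]
  | cons φ l ih =>
    simp only [List.mem_cons, exists_eq_or_imp, ← ih]
    simp [Formula.conj, Formula.vars]

theorem Formula.isQF_conj {l : List (Formula Sig)} (h : ∀ φ ∈ l, φ.IsQF) :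
    (Formula.conj l).IsQF := by
  induction l with
  | nil => trivial
  | cons φ l ih =>
    exact ⟨h φ (by simp), ih fun ψ hψ => h ψ (by simp [hψ])⟩

/-- Disjunction of a finite list of formulas. -/
def Formula.disj (l : List (Formula Sig)) : Formula Sig := l.foldr Formula.or (.neg .tru)

theorem Formula.sat_disj (l : List (Formula Sig)) (A : Interp.{u} Sig) :
    (Formula.disj l).Sat A ↔ ∃ φ ∈ l, φ.Sat A := by
  induction l with
  | nil => simp [Formula.disj, Formula.Sat]
  | cons φ l ih =>
    simp only [List.mem_cons, exists_eq_or_imp, ← ih]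
    exact Iff.rfl

theorem Formula.mem_vars_disj (l : List (Formula Sig)) (x : Var Sig) :
    x ∈ (Formula.disj l).vars ↔ ∃ φ ∈ l, x ∈ φ.vars := by
  induction l with
  | nil => simp [Formula.disj, Formula.vars]
  | cons φ l ih =>
    simp only [List.mem_cons, exists_eq_or_imp, ← ih]
    simp [Formula.disj, Formula.vars]

theorem Formula.isQF_disj {l : List (Formula Sig)} (h : ∀ φ ∈ l, φ.IsQF) :
    (Formula.disj l).IsQF := by
  induction l with
  | nil => trivial
  | cons φ l ih =>
    exact ⟨h φ (by simp), ih fun ψ hψ => h ψ (by simp [hψ])⟩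

/-- The equation between the `i`-th and the `j`-th variable of sort `σ`. -/
def Formula.varEq (σ : Sig.Srt) (i j : ℕ) : Formula Sig := .eq σ (.var (σ, i)) (.var (σ, j))

theorem Formula.sat_varEq (σ : Sig.Srt) (i j : ℕ) (A : Interp.{u} Sig) :
    (Formula.varEq σ i j).Sat A ↔ A.val (σ, i) = A.val (σ, j) := by
  simp [Formula.varEq, Formula.Sat, Interp.eval]

theorem Formula.mem_vars_varEq (σ : Sig.Srt) (i j : ℕ) (x : Var Sig) :
    x ∈ (Formula.varEq σ i j).vars ↔ x = (σ, i) ∨ x = (σ, j) := by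
  simp [Formula.varEq, Formula.vars, Term.vars]

/-- The diagonal pair `(x, x)` contributes a literal containing `x`, so even a singleton `V` is
mentioned by its arrangement. -/
theorem Formula.mem_vars_arrangement {V : Finset (Var Sig)} (E : Setoid V) {x : Var Sig}
    (hx : x ∈ V) : x ∈ (Formula.arrangement V E).vars := by
  classical
  refine (Formula.mem_vars_conj _ _).2
    ⟨_, List.mem_map.2 ⟨(⟨x, hx⟩, ⟨x, hx⟩), by simp, rfl⟩, ?_⟩
  unfold Formula.arrLit
  rw [dif_pos rfl]
  split_ifs <;> simp [Formula.vars, Term.vars]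

/-- With both variables written as pairs over the same `σ`, the cast in `arrLit` is along `rfl` and
disappears. -/
theorem Formula.sat_arrLit {V : Finset (Var Sig)} (E : Setoid V) (A : Interp.{u} Sig)
    {σ : Sig.Srt} {i j : ℕ} (hi : (σ, i) ∈ V) (hj : (σ, j) ∈ V) :
    (Formula.arrLit E ⟨(σ, i), hi⟩ ⟨(σ, j), hj⟩).Sat A ↔
      (A.val (σ, i) = A.val (σ, j) ↔ E ⟨(σ, i), hi⟩ ⟨(σ, j), hj⟩) := by
  unfold Formula.arrLit
  rw [dif_pos rfl]
  split_ifs with h <;> simp [Formula.Sat, Interp.eval, h]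

theorem Formula.sat_arrangement {V : Finset (Var Sig)} (E : Setoid V) (A : Interp.{u} Sig) :
    (Formula.arrangement V E).Sat A ↔ ∀ (σ : Sig.Srt) (i j : ℕ) (hi : (σ, i) ∈ V)
      (hj : (σ, j) ∈ V), A.val (σ, i) = A.val (σ, j) ↔ E ⟨(σ, i), hi⟩ ⟨(σ, j), hj⟩ := by
  refine (Formula.sat_conj _ _).trans ⟨fun h σ i j hi hj => ?_, fun h ψ hψ => ?_⟩
  · exact (Formula.sat_arrLit E A hi hj).1
      (h _ (List.mem_map.2 ⟨(⟨(σ, i), hi⟩, ⟨(σ, j), hj⟩), by simp, rfl⟩))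
  · obtain ⟨⟨⟨⟨σ, i⟩, hi⟩, ⟨⟨τ, j⟩, hj⟩⟩, -, rfl⟩ := List.mem_map.1 hψ
    by_cases hτ : τ = σ
    · subst hτ
      exact (Formula.sat_arrLit E A hi hj).2 (h τ i j hi hj)
    · unfold Formula.arrLit
      rw [dif_neg hτ]
      trivial

/-! ### Models whose domains are named by finitely many variables. -/

/-- Two families `g`, `h` with the same equalities between members in `P`, in finite types of the
same cardinality, are matched on `P` by a bijection. -/
theorem exists_equiv_apply_eq {ι : Type*} {X Y : Type u} [Finite X]
    (hXY : Cardinal.mk X = Cardinal.mk Y) (g : ι → X) (h : ι → Y) (P : ι → Prop)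
    (hgh : ∀ i j, P i → P j → (g i = g j ↔ h i = h j)) :
    ∃ e : X ≃ Y, ∀ i, P i → e (g i) = h i := by
  classical
  obtain ⟨e₀⟩ := Cardinal.eq.1 hXY
  have := Fintype.ofFinite X
  have := Fintype.ofEquiv X e₀
  -- By `hgh` the choice of the index does not matter; off the range of `g` on `P`, `e₀` is a mere
  -- filler.
  let f : X → Y := fun x => if hx : ∃ i, P i ∧ g i = x then h hx.choose else e₀ x
  have hf : ∀ i, P i → f (g i) = h i := by
    intro i hi
    have hx : ∃ j, P j ∧ g j = g i := ⟨i, hi, rfl⟩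
    simp only [f, dif_pos hx]
    exact (hgh _ _ hx.choose_spec.1 hi).1 hx.choose_spec.2
  -- Finiteness enters here: a partial injection between finite types of the same cardinality
  -- extends to a bijection.
  obtain ⟨e, he⟩ := Set.MapsTo.exists_equiv_extend_of_card_eq (t := Finset.univ)
    (s := {x | ∃ i, P i ∧ g i = x}) (f := f) (by simpa using Fintype.card_congr e₀)
    (fun _ _ => by simp) (by
      rintro _ ⟨i, hi, rfl⟩ _ ⟨j, hj, rfl⟩ hij
      rw [hf i hi, hf j hj] at hij
      exact (hgh i j hi hj).2 hij)
  exact ⟨e.trans (Equiv.subtypeUnivEquiv fun _ => Finset.mem_univ _), fun i hi =>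
    (he _ ⟨i, hi, rfl⟩).trans (hf i hi)⟩

/-- The values in `A` of the variables in `V` of sort `σ`. -/
def Interp.valuesOf (A : Interp.{u} Sig) (V : Finset (Var Sig)) (σ : Sig.Srt) :
    Set (A.carrier σ) := {a | ∃ i : ℕ, (σ, i) ∈ V ∧ A.val (σ, i) = a}

theorem Interp.finite_valuesOf (A : Interp.{u} Sig) (V : Finset (Var Sig)) (σ : Sig.Srt) :
    (A.valuesOf V σ).Finite := by
  have h : {i : ℕ | (σ, i) ∈ V}.Finite :=
    V.finite_toSet.preimage (Prod.mk_right_injective σ).injOn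
  exact (h.image fun i => A.val (σ, i)).subset fun a ⟨i, hi, ha⟩ => ⟨i, hi, ha⟩

/-- In a smooth theory, if `ψ` decides the equalities between its variables and has a model no
larger than the set of values of `V` in `A`, then it has a model whose domains are named by `V`, with
the equalities that hold in `A`. -/
theorem Theory.Smooth.exists_named {T : Theory Sig} {S : Set Sig.Srt} (hT : Theory.Smooth.{u} T S)
    (ψ : QF Sig) (A B : Interp.{u} Sig) (hB : T.IsModel B) (hψB : ψ.1.Sat B)
    (V : Finset (Var Sig)) (hV : ∀ x ∈ V, x.1 ∈ S)
    (hψ : ∀ C : Interp.{u} Sig, ψ.1.Sat C → ∀ σ i j, (σ, i) ∈ ψ.1.vars → (σ, j) ∈ ψ.1.vars →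
      (A.val (σ, i) = A.val (σ, j) ↔ C.val (σ, i) = C.val (σ, j)))
    (hcard : ∀ σ ∈ S, Cardinal.mk (B.carrier σ) ≤ Cardinal.mk (A.valuesOf V σ)) :
    ∃ C : Interp.{u} Sig, T.IsModel C ∧ ψ.1.Sat C ∧
      (∀ σ i j, (σ, i) ∈ V → (σ, j) ∈ V →
        (A.val (σ, i) = A.val (σ, j) ↔ C.val (σ, i) = C.val (σ, j))) ∧
      ∀ σ ∈ S, ∀ a : C.carrier σ, ∃ i, (σ, i) ∈ V ∧ C.val (σ, i) = a := by
  classical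
  -- Smoothness gives a model of `ψ` with exactly as many elements as `V` has values in `A`. Only
  -- its variable values may still be wrong.
  obtain ⟨C, hC, hψC, hcC⟩ := hT ψ B hB hψB (fun σ => Cardinal.mk (A.valuesOf V σ))
    fun σ => hcard σ σ.2
  have hex : ∀ σ (_ : σ ∈ S), ∃ e : A.valuesOf V σ ≃ C.carrier σ,
      ∀ (i : ℕ) (hi : (σ, i) ∈ V), (σ, i) ∈ ψ.1.vars →
        e ⟨A.val (σ, i), i, hi, rfl⟩ = C.val (σ, i) := by
    intro σ hσ
    have := (A.finite_valuesOf V σ).to_subtype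
    obtain ⟨e, he⟩ := exists_equiv_apply_eq (hcC ⟨σ, hσ⟩).symm
      (fun i : {i : ℕ // (σ, i) ∈ V} => (⟨A.val (σ, i), i, i.2, rfl⟩ : A.valuesOf V σ))
      (fun i => C.val (σ, i)) (fun i => (σ, i.1) ∈ ψ.1.vars)
      (fun i j hi hj => Subtype.ext_iff.trans (hψ C hψC σ i j hi hj))
    exact ⟨e, fun i hi h => he ⟨i, hi⟩ h⟩
  choose e he using hex
  -- Variables in `V` get the image under `e` of their value in `A`. On variables of `ψ` this is the
  -- old value, so `ψ` survives; injectivity of `e` preserves equalities and surjectivity gives the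
  -- naming.
  let w : ∀ x : Var Sig, C.carrier x.1 := fun x =>
    if h : x ∈ V then e x.1 (hV x h) ⟨A.val x, x.2, h, rfl⟩ else C.val x
  have hw : ∀ σ i (h : (σ, i) ∈ V), w (σ, i) = e σ (hV _ h) ⟨A.val (σ, i), i, h, rfl⟩ :=
    fun σ i h => dif_pos h
  refine ⟨C.withVal w, Theory.isModel_withVal hC w,
    (ψ.1.sat_withVal_congr C (v := C.val) fun x hx => ?_).1 hψC, fun σ i j hi hj => ?_,
    fun σ hσ a => ?_⟩
  · by_cases h : x ∈ V
    · exact ((hw x.1 x.2 h).trans (he x.1 (hV x h) x.2 h hx)).symm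
    · have hwx : w x = C.val x := dif_neg h
      exact hwx.symm
  · change _ ↔ w (σ, i) = w (σ, j)
    rw [hw σ i hi, hw σ j hj, (e σ _).injective.eq_iff, Subtype.ext_iff]
  · obtain ⟨⟨b, i, hi, rfl⟩, rfl⟩ := (e σ hσ).surjective a
    exact ⟨i, hi, hw σ i hi⟩

/-- The values of a minimal model function are finite in stably finite theories. -/
theorem Theory.IsMinimalModelFunction.lt_aleph0 {T : Theory Sig} {S : Set Sig.Srt}
    {M : QF Sig → Set (S → Cardinal.{u})} (hM : T.IsMinimalModelFunction S M)
    (hT : Theory.StablyFinite.{u} T S) {φ : QF Sig} (hφ : Theory.Satisfiable.{u} T φ.1)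
    {n : S → Cardinal.{u}} (hn : n ∈ M φ) (σ : S) : n σ < Cardinal.aleph0 := by
  obtain ⟨hM₁, hM₂, hM₃⟩ := hM φ hφ
  obtain ⟨A, hA, hφA, hnA⟩ := hM₁ n hn
  obtain ⟨B, hB, hφB, hBA⟩ := hT φ A hA hφA
  obtain ⟨m, hm, hmB⟩ := hM₃ B hB hφB
  -- Here `m ≤ |B| ≤ |A| = n` on all of `S`, and distinct minimal sizes would need `n τ < m τ` for
  -- some `τ`.
  have hmn : n = m := by
    by_contra hne
    obtain ⟨τ, hτ⟩ := hM₂ n hn m hm hne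
    exact absurd hτ (not_lt.2 (((hmB τ).trans (hBA τ τ.2).2).trans (hnA τ).ge))
  rw [hmn]
  exact (hmB σ).trans_lt (hBA σ σ.2).1

end Semantics

end ManySorted

/-- The string of the witness is assembled from `N` and `c`, which are only computable, not
primitive recursive. The concatenation is accumulated by recursion on the length of a prefix of `f
a`. -/
theorem Computable.list_flatMap {α β γ : Type*} [Primcodable α] [Primcodable β] [Primcodable γ]
    {f : α → List β} {g : α → β → List γ} (hf : Computable f) (hg : Computable₂ g) :
    Computable fun a => (f a).flatMap (g a) := by
  have hitem : Computable₂ fun (a : α) (p : ℕ × List γ) => ((f a)[p.1]?).elim ([] : List γ) (g a) :=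
    (Computable.option_casesOn
      (Computable.list_getElem?.comp (hf.comp Computable.fst)
        (Computable.fst.comp Computable.snd))
      (Computable.const [])
      (hg.comp (Computable.fst.comp Computable.fst) Computable.snd).to₂).of_eq fun p => by
        dsimp only
        cases (f p.1)[p.2.1]? <;> rfl
  refine (Computable.nat_rec (h := fun a p => p.2 ++ ((f a)[p.1]?).elim [] (g a))
    (Computable.list_length.comp hf) (Computable.const [])
    (Computable.list_append.comp (Computable.snd.comp Computable.snd) hitem).to₂).of_eq fun a => ?_
  have key : ∀ n, Nat.rec (motive := fun _ => List γ) []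
      (fun k acc => acc ++ ((f a)[k]?).elim [] (g a)) n = ((f a).take n).flatMap (g a) := by
    intro n
    induction n with
    | zero => simp
    | succ n ih =>
      simp only [ih, List.take_add_one, List.flatMap_append]
      cases (f a)[n]? <;> simp
  simpa using key (f a).length

namespace ManySorted

/-! ### Operations on strings -/

/-- The string of an equation between two variables of the sort with code `a`. -/
def eqStr (a i j : ℕ) : List Token := [(3, a, 0), (0, a, i), (0, a, j)]

/-- A bound for the indices of the variables occurring in a string. -/
def freshIdx (s : List Token) : ℕ := s.foldr (fun t r => max r (t.2.2 + 1)) 0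

/-- The pairs of variables of equal sort occurring in a string. -/
def eqTriples (s : List Token) : List (ℕ × ℕ × ℕ) :=
  (s.filter fun t => t.1 = 0).flatMap fun x => (s.filter fun t => t.1 = 0).flatMap fun y =>
    if x.2.1 = y.2.1 then [(x.2.1, x.2.2, y.2.2)] else []

/-- The strings of the formulas obtained by conjoining, for every pair in `ps`, the equation or its
negation. -/
def splitStrs (ps : List (ℕ × ℕ × ℕ)) (s : List Token) : List (List Token) :=
  ps.foldr (fun p L => L.flatMap fun t =>
    [(6, 0, 0) :: (t ++ eqStr p.1 p.2.1 p.2.2),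
      (6, 0, 0) :: (t ++ (5, 0, 0) :: eqStr p.1 p.2.1 p.2.2)]) [s]

/-- The string of the conjuncts saying that the `n` variables of the sort with code `a` that start
with the `m`-th one are distinct. -/
def distinctStr (a m n : ℕ) : List Token :=
  (List.range n).flatMap fun j => ((6, 0, 0) :: eqStr a (m + j) (m + j)) ++
    (List.range j).flatMap fun k => (6, 0, 0) :: (5, 0, 0) :: eqStr a (m + j) (m + k)

/-- The function on strings that computes the strong witness. -/
def witnessStr (l : List ℕ) (N : List Token → ℕ) (c : List Token → ℕ → ℕ → Option ℕ)
    (s : List Token) : List Token :=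
  ((splitStrs (eqTriples s) s).flatMap fun t => (List.range (N t)).flatMap fun i =>
    (7, 0, 0) :: (6, 0, 0) :: (t ++ (l.flatMap (fun a =>
      distinctStr a (freshIdx s) ((c t i a).getD 0)) ++ [(4, 0, 0)]))) ++ [(5, 0, 0), (4, 0, 0)]

/-! ### Primitive recursiveness of the string operations. -/

section Computability

open Primrec

theorem primrec_eqStr : Primrec fun p : ℕ × ℕ × ℕ => eqStr p.1 p.2.1 p.2.2 :=
  list_cons.comp (pair (const 3) (pair fst (const 0))) <|
    list_cons.comp (pair (const 0) (pair fst (fst.comp snd))) <|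
      list_cons.comp (pair (const 0) (pair fst (snd.comp snd))) (const [])

theorem primrec_freshIdx : Primrec freshIdx :=
  list_foldr (h := fun _ (p : Token × ℕ) => max p.2 (p.1.2.2 + 1)) .id (const 0) <| Primrec₂.mk <|
    nat_max.comp (snd.comp snd) (succ.comp (snd.comp (snd.comp (fst.comp snd))))

theorem primrec_eqTriples : Primrec eqTriples := by
  have hfilter : Primrec fun s : List Token => s.filter fun t => t.1 = 0 :=
    listFilter (Primrec.eq.comp fst (const 0))
  refine list_flatMap hfilter <| Primrec₂.mk <|
    list_flatMap (hfilter.comp fst) <| Primrec₂.mk <|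
      Primrec.ite (Primrec.eq.comp (fst.comp (snd.comp (snd.comp fst))) (fst.comp (snd.comp snd)))
        (list_cons.comp (pair (fst.comp (snd.comp (snd.comp fst)))
          (pair (snd.comp (snd.comp (snd.comp fst))) (snd.comp (snd.comp snd)))) (const []))
        (const [])

theorem primrec_splitStrs : Primrec₂ splitStrs := by
  have heq : Primrec fun q : ((List (ℕ × ℕ × ℕ) × List Token) ×
      ((ℕ × ℕ × ℕ) × List (List Token))) × List Token =>
      eqStr q.1.2.1.1 q.1.2.1.2.1 q.1.2.1.2.2 :=
    primrec_eqStr.comp (fst.comp (snd.comp fst))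
  refine list_foldr (h := fun _ (q : (ℕ × ℕ × ℕ) × List (List Token)) => q.2.flatMap fun t =>
      [(6, 0, 0) :: (t ++ eqStr q.1.1 q.1.2.1 q.1.2.2),
        (6, 0, 0) :: (t ++ (5, 0, 0) :: eqStr q.1.1 q.1.2.1 q.1.2.2)])
    fst (list_cons.comp snd (const [])) <| Primrec₂.mk <|
    list_flatMap (snd.comp snd) <| Primrec₂.mk <|
      list_cons.comp (list_cons.comp (const (6, 0, 0)) (list_append.comp snd heq)) <|
        list_cons.comp (list_cons.comp (const (6, 0, 0))
          (list_append.comp snd (list_cons.comp (const (5, 0, 0)) heq))) (const [])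

theorem primrec_distinctStr : Primrec fun p : ℕ × ℕ × ℕ => distinctStr p.1 p.2.1 p.2.2 := by
  have h₁ : Primrec fun q : (ℕ × ℕ × ℕ) × ℕ => eqStr q.1.1 (q.1.2.1 + q.2) (q.1.2.1 + q.2) :=
    primrec_eqStr.comp (pair (fst.comp fst)
      (pair (nat_add.comp (fst.comp (snd.comp fst)) snd)
        (nat_add.comp (fst.comp (snd.comp fst)) snd)))
  have h₂ : Primrec fun q : ((ℕ × ℕ × ℕ) × ℕ) × ℕ =>
      eqStr q.1.1.1 (q.1.1.2.1 + q.1.2) (q.1.1.2.1 + q.2) :=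
    primrec_eqStr.comp (pair (fst.comp (fst.comp fst))
      (pair (nat_add.comp (fst.comp (snd.comp (fst.comp fst))) (snd.comp fst))
        (nat_add.comp (fst.comp (snd.comp (fst.comp fst))) snd)))
  refine list_flatMap (g := fun p j => ((6, 0, 0) :: eqStr p.1 (p.2.1 + j) (p.2.1 + j)) ++
      (List.range j).flatMap fun k => (6, 0, 0) :: (5, 0, 0) :: eqStr p.1 (p.2.1 + j) (p.2.1 + k))
    (list_range.comp (snd.comp snd)) <| Primrec₂.mk <|
    list_append.comp (list_cons.comp (const (6, 0, 0)) h₁) <|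
      list_flatMap (g := fun (q : (ℕ × ℕ × ℕ) × ℕ) k => (6, 0, 0) :: (5, 0, 0) ::
          eqStr q.1.1 (q.1.2.1 + q.2) (q.1.2.1 + k)) (list_range.comp snd) <| Primrec₂.mk <|
        list_cons.comp (const (6, 0, 0)) (list_cons.comp (const (5, 0, 0)) h₂)

end Computability

/-! ### Computability of the string of the witness. -/

section Computability

open Computable

theorem computable_witnessStr (l : List ℕ) {N : List Token → ℕ}
    {c : List Token → ℕ → ℕ → Option ℕ} (hN : Computable N)
    (hc : Computable fun p : List Token × ℕ × ℕ => c p.1 p.2.1 p.2.2) :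
    Computable (witnessStr l N c) := by
  -- `q = (((s, t), i), a)`: input string, one of its splittings, index of a minimal size, code of a
  -- sort.
  have harg : Computable fun q : ((List Token × List Token) × ℕ) × ℕ => (q.1.1.2, q.1.2, q.2) :=
    pair (snd.comp (fst.comp fst)) (pair (snd.comp fst) snd)
  have hc' := option_getD (hc.comp harg) (const 0)
  have hs : Computable fun q : ((List Token × List Token) × ℕ) × ℕ => q.1.1.1 :=
    fst.comp (fst.comp fst)
  have hm := primrec_freshIdx.to_comp.comp hs
  have hsize := primrec_distinctStr.to_comp.comp (snd.pair (hm.pair hc'))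
  have hdistinct := list_append.comp (list_flatMap (const l) hsize.to₂) (const [(4, 0, 0)])
  have ht : Computable fun q : (List Token × List Token) × ℕ => q.1.2 := snd.comp fst
  have hdisj := list_cons.comp (const (7, 0, 0)) <| list_cons.comp (const (6, 0, 0)) <|
    list_append.comp ht hdistinct
  have hdisjs := list_flatMap (Primrec.list_range.to_comp.comp (hN.comp (snd (α := List Token))))
    hdisj.to₂
  have hsplit := primrec_splitStrs.to_comp.comp primrec_eqTriples.to_comp .id
  exact list_append.comp (list_flatMap hsplit hdisjs.to₂) (const [(5, 0, 0), (4, 0, 0)])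

end Computability

end ManySorted

namespace ManySorted

/-! ### The witness -/

section Witness

variable {Sig : Signature.{v}}

/-- The list of occurrences of variables in a term. -/
def Term.occ : {σ : Sig.Srt} → Term Sig σ → List (Var Sig)
  | _, .var x => [x]
  | _, .app _ args => (List.ofFn fun i => (args i).occ).flatten

/-- The list of occurrences of variables in a formula, other than those at quantifiers. -/
def Formula.occ : Formula Sig → List (Var Sig)
  | .rel _ args => (List.ofFn fun i => (args i).occ).flatten
  | .eq _ s t => s.occ ++ t.occ
  | .tru => []
  | .neg φ => φ.occ
  | .and φ ψ => φ.occ ++ ψ.occ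
  | .or φ ψ => φ.occ ++ ψ.occ
  | .all _ φ => φ.occ
  | .ex _ φ => φ.occ

theorem Term.mem_occ {σ : Sig.Srt} (t : Term Sig σ) (x : Var Sig) : x ∈ t.occ ↔ x ∈ t.vars := by
  induction t with
  | var y => simp [Term.occ, Term.vars]
  | app f args ih => simp [Term.occ, Term.vars, List.mem_ofFn, ih]

theorem Formula.mem_occ {φ : Formula Sig} (hφ : φ.IsQF) (x : Var Sig) :
    x ∈ φ.occ ↔ x ∈ φ.vars := by
  induction φ with
  | tru => simp [Formula.occ, Formula.vars]
  | eq σ s t => simp [Formula.occ, Formula.vars, Term.mem_occ]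
  | rel P args => simp [Formula.occ, Formula.vars, List.mem_ofFn, Term.mem_occ]
  | neg φ ih => simpa [Formula.occ, Formula.vars] using ih hφ
  | and φ ψ ihφ ihψ => simp [Formula.occ, Formula.vars, ihφ hφ.1, ihψ hφ.2]
  | or φ ψ ihφ ihψ => simp [Formula.occ, Formula.vars, ihφ hφ.1, ihψ hφ.2]
  | all => exact hφ.elim
  | ex => exact hφ.elim

/-- The formulas obtained from `φ` by conjoining, for every `(σ, i, j)` in the list, the equation
between the `i`-th and the `j`-th variable of sort `σ` or its negation. -/
def Formula.splits : List (Sig.Srt × ℕ × ℕ) → Formula Sig → List (Formula Sig)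
  | [], φ => [φ]
  | p :: ps, φ => (splits ps φ).flatMap fun ψ =>
      [ψ.and (varEq p.1 p.2.1 p.2.2), ψ.and (varEq p.1 p.2.1 p.2.2).neg]

theorem Formula.mem_splits_cons {p : Sig.Srt × ℕ × ℕ} {ps : List (Sig.Srt × ℕ × ℕ)}
    {φ χ : Formula Sig} : χ ∈ splits (p :: ps) φ ↔ ∃ ψ ∈ splits ps φ,
      χ = ψ.and (varEq p.1 p.2.1 p.2.2) ∨ χ = ψ.and (varEq p.1 p.2.1 p.2.2).neg := by
  simp [splits]

theorem Formula.isQF_of_mem_splits {ps : List (Sig.Srt × ℕ × ℕ)} {φ ψ : Formula Sig}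
    (hφ : φ.IsQF) (hψ : ψ ∈ splits ps φ) : ψ.IsQF := by
  induction ps generalizing ψ with
  | nil => rw [List.mem_singleton.1 hψ]; exact hφ
  | cons p ps ih =>
    obtain ⟨χ, hχ, rfl | rfl⟩ := mem_splits_cons.1 hψ <;> exact ⟨ih hχ, trivial⟩

/-- Splitting adds no variables, so indices fresh for `φ` are fresh for `ψ`, and the pairs decided
for `φ` cover all variables of `ψ`. -/
theorem Formula.vars_of_mem_splits {ps : List (Sig.Srt × ℕ × ℕ)} {φ ψ : Formula Sig}
    (hps : ∀ p ∈ ps, (p.1, p.2.1) ∈ φ.vars ∧ (p.1, p.2.2) ∈ φ.vars) (hψ : ψ ∈ splits ps φ) :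
    ψ.vars = φ.vars := by
  induction ps generalizing ψ with
  | nil => rw [List.mem_singleton.1 hψ]
  | cons p ps ih =>
    have hp := hps p (by simp)
    obtain ⟨χ, hχ, rfl | rfl⟩ := mem_splits_cons.1 hψ <;>
    · ext x
      simp only [vars, Finset.mem_union, mem_vars_varEq, ih (fun q hq => hps q (by simp [hq])) hχ]
      constructor
      · rintro (h | rfl | rfl)
        exacts [h, hp.1, hp.2]
      · exact Or.inl

theorem Formula.sat_of_mem_splits {ps : List (Sig.Srt × ℕ × ℕ)} {φ ψ : Formula Sig}
    {A : Interp.{u} Sig} (hψ : ψ ∈ splits ps φ) (hA : ψ.Sat A) : φ.Sat A := by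
  induction ps generalizing ψ with
  | nil => rwa [List.mem_singleton.1 hψ] at hA
  | cons p ps ih =>
    obtain ⟨χ, hχ, rfl | rfl⟩ := mem_splits_cons.1 hψ <;> exact ih hχ hA.1

theorem Formula.exists_mem_splits_sat (ps : List (Sig.Srt × ℕ × ℕ)) {φ : Formula Sig}
    {A : Interp.{u} Sig} (hA : φ.Sat A) : ∃ ψ ∈ splits ps φ, ψ.Sat A := by
  induction ps with
  | nil => exact ⟨φ, by simp [splits], hA⟩
  | cons p ps ih =>
    obtain ⟨χ, hχ, hχA⟩ := ih
    by_cases h : (varEq p.1 p.2.1 p.2.2).Sat A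
    · exact ⟨_, mem_splits_cons.2 ⟨χ, hχ, Or.inl rfl⟩, hχA, h⟩
    · exact ⟨_, mem_splits_cons.2 ⟨χ, hχ, Or.inr rfl⟩, hχA, h⟩

/-- `ψ` contains the equation for `p` or its negation as a conjunct, so all its models agree on it.
-/
theorem Formula.val_eq_iff_of_mem_splits {ps : List (Sig.Srt × ℕ × ℕ)} {φ ψ : Formula Sig}
    {A B : Interp.{u} Sig} (hψ : ψ ∈ splits ps φ) (hA : ψ.Sat A) (hB : ψ.Sat B)
    {p : Sig.Srt × ℕ × ℕ} (hp : p ∈ ps) :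
    A.val (p.1, p.2.1) = A.val (p.1, p.2.2) ↔ B.val (p.1, p.2.1) = B.val (p.1, p.2.2) := by
  induction ps generalizing ψ with
  | nil => simp at hp
  | cons q ps ih =>
    obtain ⟨χ, hχ, h⟩ := mem_splits_cons.1 hψ
    obtain rfl | hp := List.mem_cons.1 hp
    · rw [← sat_varEq, ← sat_varEq]
      obtain rfl | rfl := h
      · exact iff_of_true hA.2 hB.2
      · exact iff_of_false hA.2 hB.2
    · obtain rfl | rfl := h <;> exact ih hχ hA.1 hB.1 hp

/-- The conjuncts saying that the `n` variables of sort `σ` that start with the `m`-th one are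
distinct. -/
def Formula.distinctList (σ : Sig.Srt) (m n : ℕ) : List (Formula Sig) :=
  (List.range n).flatMap fun j => varEq σ (m + j) (m + j) ::
    (List.range j).map fun k => (varEq σ (m + j) (m + k)).neg

/-- The formula saying, for every `σ` in `l`, that the `n σ` variables of sort `σ` that start with
the `m`-th one are distinct. -/
def Formula.distinct (l : List Sig.Srt) (m : ℕ) (n : Sig.Srt → ℕ) : Formula Sig :=
  conj (l.flatMap fun σ => distinctList σ m (n σ))

theorem Formula.isQF_distinct (l : List Sig.Srt) (m : ℕ) (n : Sig.Srt → ℕ) :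
    (distinct l m n).IsQF := by
  refine isQF_conj fun φ hφ => ?_
  simp only [distinctList, List.mem_flatMap, List.mem_cons, List.mem_map] at hφ
  obtain ⟨σ, -, j, -, rfl | ⟨k, -, rfl⟩⟩ := hφ <;> trivial

theorem Formula.sat_distinct (l : List Sig.Srt) (m : ℕ) (n : Sig.Srt → ℕ) (A : Interp.{u} Sig) :
    (distinct l m n).Sat A ↔
      ∀ σ ∈ l, ∀ j < n σ, ∀ k < j, A.val (σ, m + j) ≠ A.val (σ, m + k) := by
  rw [distinct, sat_conj]
  constructor
  · intro h σ hσ j hj k hk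
    rw [Ne, ← sat_varEq]
    refine h (varEq σ (m + j) (m + k)).neg ?_
    simp only [distinctList, List.mem_flatMap, List.mem_cons, List.mem_map, List.mem_range]
    exact ⟨σ, hσ, j, hj, Or.inr ⟨k, hk, rfl⟩⟩
  · intro h φ hφ
    simp only [distinctList, List.mem_flatMap, List.mem_cons, List.mem_map, List.mem_range] at hφ
    obtain ⟨σ, hσ, j, hj, rfl | ⟨k, hk, rfl⟩⟩ := hφ
    · exact (sat_varEq _ _ _ A).2 rfl
    · exact fun hA => h σ hσ j hj k hk ((sat_varEq _ _ _ A).1 hA)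

/-- The trivial equations in `distinctList` serve this purpose: for `n σ = 1` there is no
inequality, yet the variable must occur in order to name an element. -/
theorem Formula.mem_vars_distinct {l : List Sig.Srt} {m : ℕ} {n : Sig.Srt → ℕ} {σ : Sig.Srt}
    (hσ : σ ∈ l) {j : ℕ} (hj : j < n σ) : (σ, m + j) ∈ (distinct l m n).vars := by
  refine (mem_vars_conj _ _).2 ⟨varEq σ (m + j) (m + j), ?_, by simp [mem_vars_varEq]⟩
  simp only [distinctList, List.mem_flatMap, List.mem_cons, List.mem_map, List.mem_range]
  exact ⟨σ, hσ, j, hj, Or.inl rfl⟩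

variable [Encodable Sig.Srt]

/-- The pairs `(σ, i)`, `(σ, j)` of variables of equal sort occurring in a formula. -/
def Formula.eqPairs (φ : Formula Sig) : List (Sig.Srt × ℕ × ℕ) :=
  φ.occ.flatMap fun x => φ.occ.flatMap fun y =>
    if Encodable.encode x.1 = Encodable.encode y.1 then [(x.1, x.2, y.2)] else []

/-- `eqPairs` compares codes of sorts, as its counterpart `eqTriples` on strings must; the coding is
injective. -/
theorem Formula.mem_eqPairs (φ : Formula Sig) (σ : Sig.Srt) (i j : ℕ) :
    (σ, i, j) ∈ φ.eqPairs ↔ (σ, i) ∈ φ.occ ∧ (σ, j) ∈ φ.occ := by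
  simp only [eqPairs, List.mem_flatMap]
  constructor
  · rintro ⟨⟨τ, a⟩, hx, ⟨τ', b⟩, hy, h⟩
    split_ifs at h with hτ
    · obtain rfl : τ = τ' := Encodable.encode_injective hτ
      simp only [List.mem_singleton, Prod.mk.injEq] at h
      obtain ⟨rfl, rfl, rfl⟩ := h
      exact ⟨hx, hy⟩
    · simp at h
  · rintro ⟨hx, hy⟩
    exact ⟨_, hx, _, hy, by simp⟩

variable [Encodable Sig.Func]

/-- Kind 0 marks variable tokens. The lists `occ` follow the order of the string, which the finset
`vars` does not, so the splitting can be computed from the string. -/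
theorem Term.filter_str {σ : Sig.Srt} (t : Term Sig σ) :
    t.str.filter (fun t => t.1 = 0) = t.occ.map fun x => (0, Encodable.encode x.1, x.2) := by
  induction t with
  | var x => simp [Term.str, Term.occ]
  | app f args ih =>
    simp [Term.str, Term.occ, List.filter_flatten, List.map_flatten, List.map_ofFn,
      Function.comp_def, ih]

variable [Encodable Sig.Rel]

/-- The strong witness of a shiny theory, where `N` and `c` compute the minimal model function and
`l` lists the sorts in `S`: some choice of equations and negated equations between the variables of
`φ` holds, and for one of its minimal sizes there are that many distinct fresh variables. -/
def Formula.witness (l : List Sig.Srt) (N : List Token → ℕ)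
    (c : List Token → ℕ → ℕ → Option ℕ) (φ : Formula Sig) : Formula Sig :=
  disj ((splits φ.eqPairs φ).flatMap fun ψ => (List.range (N ψ.str)).map fun i =>
    ψ.and (distinct l (freshIdx φ.str) fun σ => (c ψ.str i (Encodable.encode σ)).getD 0))

theorem Formula.mem_witness {l : List Sig.Srt} {N : List Token → ℕ}
    {c : List Token → ℕ → ℕ → Option ℕ} {φ χ : Formula Sig} :
    (χ ∈ (splits φ.eqPairs φ).flatMap fun ψ => (List.range (N ψ.str)).map fun i =>
      ψ.and (distinct l (freshIdx φ.str) fun σ => (c ψ.str i (Encodable.encode σ)).getD 0)) ↔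
    ∃ ψ ∈ splits φ.eqPairs φ, ∃ i < N ψ.str, ψ.and (distinct l (freshIdx φ.str) fun σ =>
      (c ψ.str i (Encodable.encode σ)).getD 0) = χ := by
  simp

theorem Formula.isQF_witness (l : List Sig.Srt) (N : List Token → ℕ)
    (c : List Token → ℕ → ℕ → Option ℕ) {φ : Formula Sig} (hφ : φ.IsQF) :
    (witness l N c φ).IsQF := by
  refine isQF_disj fun χ hχ => ?_
  obtain ⟨ψ, hψ, i, -, rfl⟩ := mem_witness.1 hχ
  exact ⟨isQF_of_mem_splits hφ hψ, isQF_distinct _ _ _⟩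

theorem Formula.sat_witness (l : List Sig.Srt) (N : List Token → ℕ)
    (c : List Token → ℕ → ℕ → Option ℕ) (φ : Formula Sig) (A : Interp.{u} Sig) :
    (witness l N c φ).Sat A ↔ ∃ ψ ∈ splits φ.eqPairs φ, ψ.Sat A ∧ ∃ i < N ψ.str,
      ∀ σ ∈ l, ∀ j < (c ψ.str i (Encodable.encode σ)).getD 0, ∀ k < j,
        A.val (σ, freshIdx φ.str + j) ≠ A.val (σ, freshIdx φ.str + k) := by
  rw [witness, sat_disj]
  constructor
  · rintro ⟨χ, hχ, hA⟩
    obtain ⟨ψ, hψ, i, hi, rfl⟩ := mem_witness.1 hχ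
    exact ⟨ψ, hψ, hA.1, i, hi, (sat_distinct _ _ _ A).1 hA.2⟩
  · rintro ⟨ψ, hψ, hψA, i, hi, hA⟩
    exact ⟨_, mem_witness.2 ⟨ψ, hψ, i, hi, rfl⟩, hψA, (sat_distinct _ _ _ A).2 hA⟩

/-! The string of the witness -/

theorem Formula.filter_str (φ : Formula Sig) :
    φ.str.filter (fun t => t.1 = 0) = φ.occ.map fun x => (0, Encodable.encode x.1, x.2) := by
  induction φ <;>
    simp_all [Formula.str, Formula.occ, List.filter_flatten, List.map_flatten, List.map_ofFn,
      Function.comp_def, Term.filter_str]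

theorem lt_freshIdx {s : List Token} {t : Token} (ht : t ∈ s) : t.2.2 < freshIdx s := by
  induction s with
  | nil => simp at ht
  | cons a s ih =>
    change _ < max (freshIdx s) (a.2.2 + 1)
    obtain rfl | h := List.mem_cons.1 ht
    · omega
    · exact (ih h).trans_le (le_max_left _ _)

theorem Formula.lt_freshIdx {φ : Formula Sig} (hφ : φ.IsQF) {x : Var Sig} (hx : x ∈ φ.vars) :
    x.2 < freshIdx φ.str := by
  have h : ((0, Encodable.encode x.1, x.2) : Token) ∈ φ.str.filter (fun t => t.1 = 0) := by
    rw [φ.filter_str]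
    exact List.mem_map.2 ⟨x, (mem_occ hφ x).2 hx, rfl⟩
  exact ManySorted.lt_freshIdx (List.mem_filter.1 h).1

theorem Formula.eqTriples_str (φ : Formula Sig) :
    eqTriples φ.str = φ.eqPairs.map fun p => (Encodable.encode p.1, p.2) := by
  unfold eqTriples eqPairs
  simp only [filter_str, List.flatMap_map, List.map_flatMap]
  congr! 4 with x y
  split_ifs <;> simp

theorem Formula.splitStrs_str (ps : List (Sig.Srt × ℕ × ℕ)) (φ : Formula Sig) :
    splitStrs (ps.map fun p => (Encodable.encode p.1, p.2)) φ.str = (splits ps φ).map str := by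
  induction ps with
  | nil => rfl
  | cons p ps ih =>
    change (splitStrs _ φ.str).flatMap _ = _
    rw [ih]
    simp [splits, List.flatMap_map, List.map_flatMap, str, Term.str, varEq, eqStr]

theorem Formula.str_conj (l : List (Formula Sig)) :
    (conj l).str = l.flatMap (fun φ => (6, 0, 0) :: φ.str) ++ [(4, 0, 0)] := by
  induction l with
  | nil => rfl
  | cons φ l ih =>
    change (6, 0, 0) :: (φ.str ++ (conj l).str) = _
    simp [ih]

theorem Formula.str_disj (l : List (Formula Sig)) :
    (disj l).str = l.flatMap (fun φ => (7, 0, 0) :: φ.str) ++ [(5, 0, 0), (4, 0, 0)] := by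
  induction l with
  | nil => rfl
  | cons φ l ih =>
    change (7, 0, 0) :: (φ.str ++ (disj l).str) = _
    simp [ih]

theorem Formula.str_distinct (l : List Sig.Srt) (m : ℕ) (n : Sig.Srt → ℕ) :
    (distinct l m n).str =
      l.flatMap (fun σ => distinctStr (Encodable.encode σ) m (n σ)) ++ [(4, 0, 0)] := by
  rw [distinct, str_conj]
  simp [distinctList, distinctStr, List.flatMap_assoc, List.flatMap_cons, List.flatMap_map, str,
    Term.str, varEq, eqStr]

theorem Formula.str_witness (l : List Sig.Srt) (N : List Token → ℕ)
    (c : List Token → ℕ → ℕ → Option ℕ) (φ : Formula Sig) :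
    (witness l N c φ).str = witnessStr (l.map Encodable.encode) N c φ.str := by
  rw [witness, str_disj, witnessStr, eqTriples_str, splitStrs_str]
  simp [List.flatMap_assoc, List.flatMap_map, str, str_distinct]

end Witness

end ManySorted

namespace ManySorted

/-! ### From shininess to a strong witness. -/

section Shiny

variable {Sig : Signature.{v}} [Encodable Sig.Srt] [Encodable Sig.Func] [Encodable Sig.Rel]
  {T : Theory Sig} {S : Set Sig.Srt}

/-- If the witness holds in `A`, then it holds in a model named by `V` with the same equalities
between the variables in `V`. -/
theorem Theory.exists_named_of_sat_witness (hT : Theory.Smooth.{u} T S)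
    (hfin : Theory.StablyFinite.{u} T S) {M : QF Sig → Set (S → Cardinal.{u})}
    (hM : T.IsMinimalModelFunction S M) {N : List Token → ℕ}
    {c : List Token → ℕ → ℕ → Option ℕ}
    (hNc : ∀ φ : QF Sig, M φ = {n | ∃ i < N φ.1.str,
      ∀ σ : S, n σ = toCard (c φ.1.str i (Encodable.encode (σ : Sig.Srt)))})
    {l : List Sig.Srt} (hl : ∀ σ, σ ∈ l ↔ σ ∈ S) (φ : QF Sig) {A : Interp.{u} Sig}
    (hA : T.IsModel A) (hφA : (φ.1.witness l N c).Sat A) (V : Finset (Var Sig))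
    (hVS : ∀ x ∈ V, x.1 ∈ S) (hφV : ∀ x ∈ (φ.1.witness l N c).vars, x.1 ∈ S → x ∈ V) :
    ∃ C : Interp.{u} Sig, T.IsModel C ∧ φ.1.Sat C ∧ (φ.1.witness l N c).Sat C ∧
      (∀ σ i j, (σ, i) ∈ V → (σ, j) ∈ V →
        (A.val (σ, i) = A.val (σ, j) ↔ C.val (σ, i) = C.val (σ, j))) ∧
      ∀ σ ∈ S, ∀ a : C.carrier σ, ∃ i, (σ, i) ∈ V ∧ C.val (σ, i) = a := by
  classical
  obtain ⟨ψ, hψ, hψA, i, hi, hdist⟩ := (Formula.sat_witness l N c φ.1 A).1 hφA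
  have hψQF : ψ.IsQF := Formula.isQF_of_mem_splits φ.2 hψ
  have hvars : ψ.vars = φ.1.vars := by
    refine Formula.vars_of_mem_splits (fun p hp => ?_) hψ
    simpa only [Formula.mem_occ φ.2] using (φ.1.mem_eqPairs p.1 p.2.1 p.2.2).1 hp
  have hfresh : ∀ σ ∈ S, ∀ j < (c ψ.str i (Encodable.encode σ)).getD 0,
      (σ, freshIdx φ.1.str + j) ∈ V := fun σ hσ j hj =>
    hφV _ ((Formula.mem_vars_disj _ _).2 ⟨_, Formula.mem_witness.2 ⟨ψ, hψ, i, hi, rfl⟩,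
      Finset.mem_union_right _ (Formula.mem_vars_distinct ((hl σ).2 hσ) hj)⟩) hσ
  have hmem : (fun σ : S => toCard (c ψ.str i (Encodable.encode (σ : Sig.Srt)))) ∈
      M ⟨ψ, hψQF⟩ := by
    rw [hNc]
    exact ⟨i, hi, fun σ => rfl⟩
  have hsat : Theory.Satisfiable.{u} T ψ := ⟨A, hA, hψA⟩
  obtain ⟨B, hB, hψB, hcard⟩ := (hM ⟨ψ, hψQF⟩ hsat).1 _ hmem
  obtain ⟨C, hC, hψC, hpat, hnamed⟩ := hT.exists_named ⟨ψ, hψQF⟩ A B hB hψB V hVS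
    (fun C hψC σ i j hi hj => by
      refine Formula.val_eq_iff_of_mem_splits (p := (σ, i, j)) hψ hψA hψC
        ((φ.1.mem_eqPairs σ i j).2 ?_)
      rw [Formula.mem_occ φ.2, Formula.mem_occ φ.2, ← hvars]
      exact ⟨hi, hj⟩)
    (fun σ hσ => by
      rw [← hcard ⟨σ, hσ⟩]
      -- Since `ψ` is satisfiable, its minimal sizes are finite, so the default of `getD` plays no
      -- role.
      have hlt := hM.lt_aleph0 hfin (φ := ⟨ψ, hψQF⟩) hsat hmem ⟨σ, hσ⟩
      have hdσ := hdist σ ((hl σ).2 hσ)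
      have hfσ := hfresh σ hσ
      dsimp only at hlt ⊢
      cases hn : c ψ.str i (Encodable.encode σ) with
      | none => simp [hn, toCard] at hlt
      | some n =>
        simp only [hn, Option.getD_some] at hdσ hfσ
        -- The fresh variables lie in `V` and have `n` distinct values in `A`, which bounds the size
        -- of the minimal model `B`.
        let f : ULift.{u} (Fin n) → A.valuesOf V σ := fun j =>
          ⟨A.val (σ, freshIdx φ.1.str + j.down), _, hfσ _ j.down.2, rfl⟩
        have hf : Function.Injective f := by
          intro j k hjk
          have hjk : A.val (σ, freshIdx φ.1.str + j.down) = A.val (σ, freshIdx φ.1.str + k.down) :=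
            congrArg Subtype.val hjk
          refine ULift.ext _ _ (Fin.ext ?_)
          rcases lt_trichotomy (j.down : ℕ) k.down with h | h | h
          · exact absurd hjk.symm (hdσ _ k.down.2 _ h)
          · exact h
          · exact absurd hjk (hdσ _ j.down.2 _ h)
        simpa [toCard] using Cardinal.mk_le_of_injective hf)
  -- `C` satisfies the same disjunct as `A`: it has the same equalities on `V`, so the fresh
  -- variables stay distinct.
  refine ⟨C, hC, Formula.sat_of_mem_splits hψ hψC,
    (Formula.sat_witness l N c φ.1 C).2 ⟨ψ, hψ, hψC, i, hi, fun σ hσ j hj k hk => ?_⟩, hpat, hnamed⟩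
  have hσS := (hl σ).1 hσ
  exact fun h => hdist σ hσ j hj k hk
    ((hpat σ _ _ (hfresh σ hσS j hj) (hfresh σ hσS k (hk.trans hj))).2 h)

/-- In a stably finite theory with a minimal model function, the witness can be satisfied by
changing the values of fresh variables. -/
theorem Theory.exists_withVal_sat_witness (hfin : Theory.StablyFinite.{u} T S)
    {M : QF Sig → Set (S → Cardinal.{u})} (hM : T.IsMinimalModelFunction S M)
    {N : List Token → ℕ} {c : List Token → ℕ → ℕ → Option ℕ}
    (hNc : ∀ φ : QF Sig, M φ = {n | ∃ i < N φ.1.str,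
      ∀ σ : S, n σ = toCard (c φ.1.str i (Encodable.encode (σ : Sig.Srt)))})
    {l : List Sig.Srt} (hl : ∀ σ, σ ∈ l ↔ σ ∈ S) (φ : QF Sig) {A : Interp.{u} Sig}
    (hA : T.IsModel A) (hφA : φ.1.Sat A) :
    ∃ w : ∀ x : Var Sig, A.carrier x.1, (∀ x ∈ φ.1.vars, w x = A.val x) ∧
      (φ.1.witness l N c).Sat (A.withVal w) := by
  classical
  obtain ⟨ψ, hψ, hψA⟩ := Formula.exists_mem_splits_sat φ.1.eqPairs hφA
  have hψQF : ψ.IsQF := Formula.isQF_of_mem_splits φ.2 hψ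
  have hvars : ψ.vars = φ.1.vars := by
    refine Formula.vars_of_mem_splits (fun p hp => ?_) hψ
    simpa only [Formula.mem_occ φ.2] using (φ.1.mem_eqPairs p.1 p.2.1 p.2.2).1 hp
  have hsat : Theory.Satisfiable.{u} T ψ := ⟨A, hA, hψA⟩
  -- Some minimal size lies below `A`, so `A` has enough elements for that many distinct values.
  obtain ⟨n, hn, hnA⟩ := (hM ⟨ψ, hψQF⟩ hsat).2.2 A hA hψA
  have hlt := hM.lt_aleph0 hfin (φ := ⟨ψ, hψQF⟩) hsat hn
  rw [hNc] at hn
  obtain ⟨i, hi, hni⟩ := hn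
  have hemb : ∀ σ, ∃ g : ℕ → A.carrier σ, σ ∈ S →
      Set.InjOn g {j | j < (c ψ.str i (Encodable.encode σ)).getD 0} := by
    intro σ
    by_cases hσ : σ ∈ S
    · have hσn := hni ⟨σ, hσ⟩
      have hσA := hnA ⟨σ, hσ⟩
      have hσlt := hlt ⟨σ, hσ⟩
      rw [hσn] at hσA hσlt
      dsimp only at hσA hσlt
      cases hk : c ψ.str i (Encodable.encode σ) with
      | none => simp [hk, toCard] at hσlt
      | some k =>
        rw [hk] at hσA
        have hle : Cardinal.mk (ULift.{u} (Fin k)) ≤ Cardinal.mk (A.carrier σ) := by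
          simpa [toCard] using hσA
        obtain ⟨e⟩ := (Cardinal.le_def _ _).1 hle
        have := A.nonempty_carrier σ
        refine ⟨fun j => if h : j < k then e ⟨⟨j, h⟩⟩ else Classical.arbitrary _,
          fun _ a ha b hb hab => ?_⟩
        simp only [Option.getD_some, Set.mem_ofPred_eq] at ha hb
        simpa [ha, hb] using hab
    · have := A.nonempty_carrier σ
      exact ⟨fun _ => Classical.arbitrary _, fun h => absurd h hσ⟩
  choose g hg using hemb
  -- All variables of `φ` have index below `freshIdx`, so they keep their values.
  let w : ∀ x : Var Sig, A.carrier x.1 := fun x =>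
    if x.2 < freshIdx φ.1.str then A.val x else g x.1 (x.2 - freshIdx φ.1.str)
  have hw : ∀ x ∈ φ.1.vars, w x = A.val x := fun x hx => if_pos (Formula.lt_freshIdx φ.2 hx)
  have hwg : ∀ σ j, w (σ, freshIdx φ.1.str + j) = g σ j := fun σ j => by simp [w]
  refine ⟨w, hw, (Formula.sat_witness l N c φ.1 _).2 ⟨ψ, hψ,
    (ψ.sat_withVal_congr A (v := A.val) fun x hx => (hw x (hvars ▸ hx)).symm).1 hψA,
    i, hi, fun σ hσ j hj k hk => ?_⟩⟩
  intro (h : w (σ, freshIdx φ.1.str + j) = w (σ, freshIdx φ.1.str + k))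
  rw [hwg, hwg] at h
  exact hk.ne' (hg σ ((hl σ).1 hσ) hj (hk.trans hj) h)

/-- Shiny theories are strongly finitely witnessable. -/
theorem Theory.Shiny.stronglyFinitelyWitnessable (hS : S.Finite) (hT : Theory.Shiny.{u} T S) :
    Theory.StronglyFinitelyWitnessable.{u} T S := by
  classical
  obtain ⟨hsm, hfin, M, hM, N, c, hN, hc, hNc⟩ := hT
  have hl : ∀ σ, σ ∈ hS.toFinset.toList ↔ σ ∈ S := by simp
  generalize hS.toFinset.toList = l at hl
  refine ⟨fun φ => ⟨φ.1.witness l N c, Formula.isQF_witness l N c φ.2⟩,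
    ⟨⟨witnessStr (l.map Encodable.encode) N c, computable_witnessStr _ hN hc,
      fun φ => (φ.1.str_witness l N c).symm⟩, fun φ => ⟨fun A hA => ?_, ?_⟩⟩, ?_⟩
  · rw [Formula.sat_exs]
    constructor
    · intro hφA
      obtain ⟨w, hw, hwA⟩ := Theory.exists_withVal_sat_witness hfin hM hNc hl φ hA hφA
      -- `w` may also change variables outside the witness, which the quantifiers do not bind; these
      -- changes are undone.
      refine ⟨fun x => if x ∈ (φ.1.witness l N c).vars \ φ.1.vars then w x else A.val x,
        fun x hx => by simp only [if_neg hx], ?_⟩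
      refine (Formula.sat_withVal_congr A _ fun x hx => ?_).1 hwA
      by_cases hxφ : x ∈ φ.1.vars
      · simp [hxφ, hw x hxφ]
      · simp [hxφ, hx]
    · rintro ⟨w, hw, hwA⟩
      obtain ⟨ψ, hψ, hψA, -⟩ := (Formula.sat_witness l N c φ.1 _).1 hwA
      exact (Formula.sat_withVal_congr A φ.1 fun x hx => hw x (by simp [hx])).1
        (Formula.sat_of_mem_splits hψ hψA)
  · rintro ⟨A, hA, hφA⟩
    obtain ⟨C, hC, hφC, -, -, hnamed⟩ := Theory.exists_named_of_sat_witness hsm hfin hM hNc hl φ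
      hA hφA ((φ.1.witness l N c).vars.filter fun x => x.1 ∈ S)
      (fun x hx => (Finset.mem_filter.1 hx).2) fun x hx hxS => Finset.mem_filter.2 ⟨hx, hxS⟩
    refine ⟨C, hC, hφC, fun σ hσ => (Set.eq_univ_of_forall fun a => ?_).symm⟩
    obtain ⟨i, hi, hia⟩ := hnamed σ hσ a
    exact ⟨i, (Finset.mem_filter.1 hi).1, hia⟩
  · rintro φ V E hVS - ⟨A, hA, hφA, hEA⟩
    -- The naming set consists of all variables of `χ` with sort in `S`; it contains `V`, so
    -- preserving its equalities preserves the arrangement.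
    let χ := (φ.1.witness l N c).and (Formula.arrangement V E)
    have hV : ∀ x ∈ V, x ∈ χ.vars.filter fun x => x.1 ∈ S := fun x hx =>
      Finset.mem_filter.2
        ⟨Finset.mem_union_right _ (Formula.mem_vars_arrangement E hx), hVS x hx⟩
    obtain ⟨C, hC, -, hφC, hpat, hnamed⟩ := Theory.exists_named_of_sat_witness hsm hfin hM hNc hl φ
      hA hφA (χ.vars.filter fun x => x.1 ∈ S)
      (fun x hx => (Finset.mem_filter.1 hx).2)
      fun x hx hxS => Finset.mem_filter.2 ⟨Finset.mem_union_left _ hx, hxS⟩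
    refine ⟨C, hC, ⟨hφC, (Formula.sat_arrangement E C).2 fun σ i j hi hj => ?_⟩,
      fun σ hσ => (Set.eq_univ_of_forall fun a => ?_).symm⟩
    · exact (hpat σ i j (hV _ hi) (hV _ hj)).symm.trans
        ((Formula.sat_arrangement E A).1 hEA σ i j hi hj)
    · obtain ⟨i, hi, hia⟩ := hnamed σ hσ a
      exact ⟨i, (Finset.mem_filter.1 hi).1, hia⟩

/-- A polite theory with models has only finitely many sorts in `S`. -/
theorem Theory.Polite.finite (hT : Theory.Polite.{u} T S) {A : Interp.{u} Sig}
    (hA : T.IsModel A) : S.Finite := by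
  classical
  obtain ⟨-, wit, -, hwit⟩ := hT
  -- The witness of `tru` is satisfiable because `T` has a model. In a model named by it, each
  -- nonempty domain over `S` needs a variable of its sort among finitely many.
  obtain ⟨heq, hsat⟩ := hwit ⟨.tru, trivial⟩
  obtain ⟨w, -, hw⟩ := (Formula.sat_exs _ _ A).1 ((heq A hA).1 trivial)
  obtain ⟨B, -, -, hB⟩ := hsat ⟨A.withVal w, Theory.isModel_withVal hA w, hw⟩
  refine ((wit ⟨.tru, trivial⟩).1.vars.image Prod.fst).finite_toSet.subset fun σ hσ => ?_
  obtain ⟨a⟩ := B.nonempty_carrier σ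
  obtain ⟨i, hi, -⟩ := (hB σ hσ).le (Set.mem_univ a)
  exact Finset.mem_coe.2 (Finset.mem_image.2 ⟨(σ, i), hi, rfl⟩)

/-- A theory without models is strongly polite. -/
theorem Theory.stronglyPolite_of_forall_not_isModel (hT : ∀ A : Interp.{u} Sig, ¬ T.IsModel A) :
    Theory.StronglyPolite.{u} T S :=
  ⟨fun _ A hA => absurd hA (hT A), id, ⟨⟨id, Computable.id, fun _ => rfl⟩, fun _ =>
    ⟨fun A hA => absurd hA (hT A), fun ⟨A, hA, _⟩ => absurd hA (hT A)⟩⟩,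
    fun _ _ _ _ _ ⟨A, hA, _⟩ => absurd hA (hT A)⟩

end Shiny

end ManySorted

/-! ### The theorem. -/

theorem mainTheorem2 (Sig : ManySorted.Signature.{v})
    [Encodable Sig.Srt] [Encodable Sig.Func] [Encodable Sig.Rel] :
    (∀ (T : ManySorted.Theory Sig) (S : Set Sig.Srt), S.Finite →
      ManySorted.Theory.Shiny.{u} T S → ManySorted.Theory.StronglyPolite.{u} T S) ∧
    ¬ ∃ (T : ManySorted.Theory Sig) (S : Set Sig.Srt), ManySorted.Theory.Unicorn3.{u} T S := by
  refine ⟨fun T S hS hT => ⟨hT.1, hT.stronglyFinitelyWitnessable hS⟩, ?_⟩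
  rintro ⟨T, S, hpolite, hshiny, hstrong⟩
  by_cases hT : ∃ A : ManySorted.Interp.{u} Sig, T.IsModel A
  · obtain ⟨A, hA⟩ := hT
    exact hstrong ⟨hshiny.1, hshiny.stronglyFinitelyWitnessable (hpolite.finite hA)⟩
  · exact hstrong (ManySorted.Theory.stronglyPolite_of_forall_not_isModel (not_exists.1 hT))
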